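/- Let $D=(V,A)$ be a finite loopless directed multigraph (parallel and anti-parallel arcs are allowed). For vertices $x,y$ let $\lambda_D(x,y)$ denote the maximum number of pairwise arc-disjoint directed paths from $x$ to $y$ in $D$, with the convention $\lambda_D(x,x)=\infty$ (and $\infty\pm1=\infty$). Let $P$ be a directed path in $D$ from a vertex $u$ to a vertex $v$, and let $D^{P}$ be the digraph obtained from $D$ by reversing all arcs of $P$. Then: (1) for all vertices $u',v'\in V$, $$\lambda_{D^{P}}(u',v')\ \ge\ \min\bigl(\lambda_D(u,v)-1,\ \lambda_D(u',v')\bigr);$$ (2) $\lambda_{D^{P}}(u,v)=\lambda_D(u,v)-1$. Call a digraph $k$-arc-connected if at least $k$ arcs have to be deleted in order to destroy its strong connectivity (that is, it remains strongly connected after the deletion of any fewer than $k$ arcs), and call a directed path $Q$ in a $k$-arc-connected digraph $D$ flippable if $D^{Q}$ is again $k$-arc-connected. Then moreover: (3) for every $k\in\mathbb{N}=\{0,1,2,\dots\}$ such that $D$ is $k$-arc-connected, the path $P$ is flippable if and only if all directed paths from $u$ to $v$ in $D$ are flippable, and this holds if and only if $\lambda_D(u,v)>k$. -/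

import Mathlib

/-- A loopless directed multigraph with vertex set `V` and arc set `A`: arcs are individual objects
with a tail `src` and a head `tgt`, so parallel and anti-parallel arcs are allowed. -/
structure MultiDigraph (V A : Type*) where
  src : A → V
  tgt : A → V
  loopless : ∀ a, src a ≠ tgt a

namespace MultiDigraph

open Classical in
/-- The digraph obtained from `D` by reversing the arcs in `B`. -/
noncomputable def reverse {V A : Type*} (D : MultiDigraph V A) (B : Set A) : MultiDigraph V A where
  src a := if a ∈ B then D.tgt a else D.src a
  tgt a := if a ∈ B then D.src a else D.tgt a
  loopless a := by
    by_cases h : a ∈ B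
    · simpa [h] using (D.loopless a).symm
    · simpa [h] using D.loopless a

/-- `D.IsWalk u P v`: the arcs in the list `P`, in this order, form a directed walk from `u` to
`v`. -/
def IsWalk {V A : Type*} (D : MultiDigraph V A) : V → List A → V → Prop
  | u, [], v => u = v
  | u, a :: P, v => D.src a = u ∧ D.IsWalk (D.tgt a) P v

/-- `D.IsPath u P v`: the list of arcs `P` is a directed path from `u` to `v`, that is, a directed
walk that visits no vertex twice (`u :: P.map D.tgt` is the list of the vertices visited). -/
def IsPath {V A : Type*} (D : MultiDigraph V A) (u : V) (P : List A) (v : V) : Prop :=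
  D.IsWalk u P v ∧ (u :: P.map D.tgt).Nodup

/-- The digraph obtained from `D` by reversing all arcs of the path `P`. -/
noncomputable def reversePath {V A : Type*} (D : MultiDigraph V A) (P : List A) :
    MultiDigraph V A :=
  D.reverse {a | a ∈ P}

/-- There are `n` pairwise arc-disjoint directed paths from `u` to `v`. -/
def HasDisjointPaths {V A : Type*} (D : MultiDigraph V A) (u v : V) (n : ℕ) : Prop :=
  ∃ P : Fin n → List A, (∀ i, D.IsPath u (P i) v) ∧ Pairwise fun i j => (P i).Disjoint (P j)

/-- The maximum number of pairwise arc-disjoint directed paths from `u` to `v`. If there are finitely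
many arcs and `u ≠ v`, this is a natural number and the maximum is attained. If `u = v`, arbitrarily
many copies of the path without arcs are pairwise arc-disjoint, and the value is `⊤`. -/
noncomputable def lam {V A : Type*} (D : MultiDigraph V A) (u v : V) : ℕ∞ :=
  ⨆ (n : ℕ) (_ : D.HasDisjointPaths u v n), (n : ℕ∞)

/-- After deleting the arcs in `B` there is a directed path from every vertex to every vertex. -/
def IsStronglyConnectedWithout {V A : Type*} (D : MultiDigraph V A) (B : Finset A) : Prop :=
  ∀ u v : V, ∃ P : List A, D.IsPath u P v ∧ ∀ a ∈ P, a ∉ B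

/-- `k`-arc-connectivity: at least `k` arcs have to be deleted in order to destroy strong
connectivity. -/
def IsArcConnected {V A : Type*} (D : MultiDigraph V A) (k : ℕ) : Prop :=
  ∀ B : Finset A, B.card < k → D.IsStronglyConnectedWithout B

/-- A path `P` (of a `k`-arc-connected digraph `D`) is flippable if reversing it leaves a
`k`-arc-connected digraph. -/
def IsFlippable {V A : Type*} (D : MultiDigraph V A) (k : ℕ) (P : List A) : Prop :=
  (D.reversePath P).IsArcConnected k

end MultiDigraph

namespace MultiDigraph

/-! By Menger, λ(x, y) is the least out-degree of a set X with x ∈ X and y ∉ X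
(`natCast_le_lam_iff`). Reversing P changes the out-degree of X by 1_X(v) - 1_X(u)
(`IsPath.card_outArcs_reversePath`). So every cut from u to v drops by exactly one, which gives (2).
No other cut drops, and one that drops had out-degree at least λ(u, v), which gives (1). Since
k-arc-connectivity means that all λ are at least k, (3) follows. Menger itself is proved by
induction through the same reversal count, with flows recombined by `IsFlow.augment`. -/

open Classical in
/-- The set of arcs leaving the vertex set `X`. -/
noncomputable def outArcs {V A : Type*} [Fintype A] (D : MultiDigraph V A) (X : Set V) :
    Finset A :=
  Finset.univ.filter fun a => D.src a ∈ X ∧ D.tgt a ∉ X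

/-- The arcs in `B` carry an integral flow of value `n` from `x` to `y`. Conservation is tested
against all potentials `g`. -/
def IsFlow {V A : Type*} (D : MultiDigraph V A) (B : Finset A) (x y : V) (n : ℕ) : Prop :=
  ∀ g : V → ℤ, ∑ a ∈ B, (g (D.src a) - g (D.tgt a)) = n * (g x - g y)

section Walks

variable {V A : Type*} {D : MultiDigraph V A}

theorem IsWalk.append_arc {x : V} {P : List A} {a : A} (h : D.IsWalk x P (D.src a)) :
    D.IsWalk x (P ++ [a]) (D.tgt a) := by
  induction P generalizing x with
  | nil => exact ⟨h.symm, rfl⟩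
  | cons b P ih => exact ⟨h.1, ih h.2⟩

theorem IsPath.exists_suffix {w x y : V} {Q : List A} (h : D.IsPath w Q y)
    (hx : x ∈ w :: Q.map D.tgt) : ∃ R, D.IsPath x R y ∧ R ⊆ Q := by
  induction Q generalizing w with
  | nil =>
    obtain rfl : x = w := by simpa using hx
    exact ⟨[], h, List.Subset.refl _⟩
  | cons a Q ih =>
    rcases List.mem_cons.1 hx with rfl | hx
    · exact ⟨_, h, List.Subset.refl _⟩
    · obtain ⟨R, hR, hs⟩ := ih ⟨h.1.2, (List.nodup_cons.1 h.2).2⟩ hx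
      exact ⟨R, hR, List.subset_cons_of_subset _ hs⟩

theorem IsWalk.exists_path {x y : V} {P : List A} (h : D.IsWalk x P y) :
    ∃ Q, D.IsPath x Q y ∧ Q ⊆ P := by
  induction P generalizing x with
  | nil => exact ⟨[], ⟨h, by simp⟩, List.Subset.refl _⟩
  | cons a P ih =>
    obtain ⟨Q, hQ, hs⟩ := ih h.2
    by_cases hx : x ∈ D.tgt a :: Q.map D.tgt
    · obtain ⟨R, hR, hRs⟩ := hQ.exists_suffix hx
      exact ⟨R, hR, List.subset_cons_of_subset _ (List.Subset.trans hRs hs)⟩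
    · exact ⟨a :: Q, ⟨⟨h.1, hQ.1⟩, List.nodup_cons.2 ⟨hx, hQ.2⟩⟩, List.cons_subset_cons _ hs⟩

/-- Either `y` can be reached from `x` inside `S`, or a cut contains no arc of `S`. -/
theorem exists_path_or_cut (D : MultiDigraph V A) (S : Set A) (x y : V) :
    (∃ P, D.IsPath x P y ∧ ∀ a ∈ P, a ∈ S) ∨
      ∃ X : Set V, x ∈ X ∧ y ∉ X ∧ ∀ a ∈ S, D.src a ∈ X → D.tgt a ∈ X := by
  by_cases hy : ∃ P, D.IsWalk x P y ∧ ∀ a ∈ P, a ∈ S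
  · obtain ⟨P, hP, hS⟩ := hy
    obtain ⟨Q, hQ, hs⟩ := hP.exists_path
    exact .inl ⟨Q, hQ, fun a ha => hS a (hs ha)⟩
  · refine .inr ⟨{w | ∃ P, D.IsWalk x P w ∧ ∀ a ∈ P, a ∈ S}, ⟨[], rfl, by simp⟩, hy, ?_⟩
    rintro a ha ⟨P, hP, hS⟩
    refine ⟨P ++ [a], hP.append_arc, fun b hb => ?_⟩
    rcases List.mem_append.1 hb with hb | hb
    · exact hS b hb
    · rwa [List.mem_singleton.1 hb]

theorem IsWalk.exists_leaving {x y : V} {P : List A} (h : D.IsWalk x P y) {X : Set V}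
    (hx : x ∈ X) (hy : y ∉ X) : ∃ a ∈ P, D.src a ∈ X ∧ D.tgt a ∉ X := by
  induction P generalizing x with
  | nil => exact absurd (h ▸ hx) hy
  | cons a P ih =>
    by_cases ht : D.tgt a ∈ X
    · obtain ⟨b, hb, hb'⟩ := ih h.2 ht
      exact ⟨b, List.mem_cons_of_mem _ hb, hb'⟩
    · exact ⟨a, List.mem_cons_self, h.1.symm ▸ hx, ht⟩

theorem IsWalk.sum_potential {x y : V} {P : List A} (h : D.IsWalk x P y) (g : V → ℤ) :
    (P.map fun a => g (D.src a) - g (D.tgt a)).sum = g x - g y := by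
  induction P generalizing x with
  | nil => cases h; simp
  | cons a P ih =>
    rw [List.map_cons, List.sum_cons, ih h.2, h.1]
    ring

open Classical in
theorem IsPath.sum_potential {x y : V} {P : List A} (h : D.IsPath x P y) (g : V → ℤ) :
    ∑ a ∈ P.toFinset, (g (D.src a) - g (D.tgt a)) = g x - g y := by
  rw [List.sum_toFinset _ (List.Nodup.of_map _ (List.nodup_cons.1 h.2).2), h.1.sum_potential]

/-- An integral flow of value `n` decomposes into `n` arc-disjoint paths and a remainder. -/
theorem IsFlow.exists_paths {x y : V} {n : ℕ} {B : Finset A}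
    (hB : D.IsFlow B x y n) :
    ∃ P : Fin n → List A, (∀ i, D.IsPath x (P i) y) ∧
      (Pairwise fun i j => (P i).Disjoint (P j)) ∧ ∀ i, ∀ a ∈ P i, a ∈ B := by
  classical
  induction n generalizing B with
  | zero => exact ⟨fun _ => [], fun i => i.elim0, fun i => i.elim0, fun i => i.elim0⟩
  | succ n ih =>
    rcases D.exists_path_or_cut (B : Set A) x y with ⟨P, hP, hPB⟩ | ⟨X, hx, hy, hX⟩
    · have hs : P.toFinset ⊆ B := fun a ha => hPB a (List.mem_toFinset.1 ha)
      obtain ⟨Q, hQ, hd, hQB⟩ := ih (B := B \ P.toFinset) fun g => by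
        have h1 := Finset.sum_sdiff (f := fun a => g (D.src a) - g (D.tgt a)) hs
        rw [hP.sum_potential g, hB g] at h1
        push_cast at h1
        linarith
      have hPQ : ∀ i, P.Disjoint (Q i) := fun i a ha ha' => by
        simpa [ha] using hQB i a ha'
      refine ⟨Fin.cons P Q, Fin.cases hP hQ, ?_, Fin.cases hPB fun i a ha =>
        (Finset.mem_sdiff.1 (hQB i a ha)).1⟩
      intro i j hij
      induction i using Fin.cases with
      | zero =>
        induction j using Fin.cases with
        | zero => exact absurd rfl hij
        | succ j => exact hPQ j
      | succ i =>
        induction j using Fin.cases with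
        | zero => exact (hPQ i).symm
        | succ j => exact hd fun e => hij (congrArg Fin.succ e)
    · exfalso
      -- Tested against the indicator of X, the flow has value n + 1 > 0, yet no arc of B leaves X.
      -- Cycles in B do no harm.
      have h1 := hB fun w => if w ∈ X then 1 else 0
      have h2 : ∑ a ∈ B, ((if D.src a ∈ X then (1 : ℤ) else 0) - if D.tgt a ∈ X then 1 else 0)
          ≤ 0 := by
        refine Finset.sum_nonpos fun a ha => ?_
        have := hX a ha
        split_ifs <;> simp_all
      simp only [hx, hy, if_true, if_false] at h1
      push_cast at h1
      linarith

end Walks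

section Flows

variable {V A : Type*} [Fintype A] {D : MultiDigraph V A}

theorem mem_outArcs {X : Set V} {a : A} : a ∈ D.outArcs X ↔ D.src a ∈ X ∧ D.tgt a ∉ X := by
  simp [outArcs]

open Classical in
/-- Reversing a path from `u` to `v` lowers the out-degree of `X` by `1_X(u) - 1_X(v)`. -/
theorem IsPath.card_outArcs_reversePath {u v : V} {P : List A} (h : D.IsPath u P v) (X : Set V) :
    (((D.reversePath P).outArcs X).card : ℤ) =
      (D.outArcs X).card - ((if u ∈ X then 1 else 0) - (if v ∈ X then 1 else 0)) := by
  -- Writing the correction as a telescoped sum along P reduces the claim to a check arc by arc.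
  rw [← h.sum_potential fun w => if w ∈ X then 1 else 0, outArcs, outArcs, Finset.card_filter,
    Finset.card_filter, ← Finset.univ_inter P.toFinset, ← Finset.sum_ite_mem]
  push_cast
  rw [← Finset.sum_sub_distrib]
  refine Finset.sum_congr rfl fun a _ => ?_
  by_cases hP : a ∈ P <;> by_cases hs : D.src a ∈ X <;> by_cases ht : D.tgt a ∈ X <;>
    simp [reversePath, reverse, hP, hs, ht]

-- An arc in both P and Q is traversed in opposite directions, so its contributions cancel; hence
-- the symmetric difference.
open Classical in
theorem IsFlow.augment {x y : V} {P : List A} (h : D.IsPath x P y) {Q : Finset A} {n : ℕ}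
    (hQ : (D.reversePath P).IsFlow Q x y n) :
    D.IsFlow (symmDiff P.toFinset Q) x y (n + 1) := by
  intro g
  have h1 := h.sum_potential g
  have h2 := hQ g
  rw [← Finset.univ_inter P.toFinset, ← Finset.sum_ite_mem] at h1
  rw [← Finset.univ_inter Q, ← Finset.sum_ite_mem] at h2
  rw [← Finset.univ_inter (symmDiff _ _), ← Finset.sum_ite_mem]
  push_cast
  rw [add_mul, ← h2, one_mul, ← h1, ← Finset.sum_add_distrib]
  refine Finset.sum_congr rfl fun a _ => ?_
  by_cases hP : a ∈ P <;> by_cases hq : a ∈ Q <;>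
    simp [Finset.mem_symmDiff, reversePath, reverse, hP, hq]

/-- Menger's theorem, in terms of flows. -/
theorem exists_isFlow (D : MultiDigraph V A) {x y : V} {n : ℕ}
    (h : ∀ X : Set V, x ∈ X → y ∉ X → n ≤ (D.outArcs X).card) : ∃ B, D.IsFlow B x y n := by
  classical
  induction n generalizing D with
  | zero => exact ⟨∅, fun g => by simp⟩
  | succ n ih =>
    rcases D.exists_path_or_cut Set.univ x y with ⟨P, hP, -⟩ | ⟨X, hx, hy, hX⟩
    -- Reversing P lowers each cut from x to y by exactly one, so the bound n survives.
    · obtain ⟨Q, hQ⟩ := ih (D.reversePath P) fun X hx hy => by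
        have := hP.card_outArcs_reversePath X
        have := h X hx hy
        simp only [hx, hy, if_true, if_false] at *
        omega
      exact ⟨_, IsFlow.augment hP hQ⟩
    · have := h X hx hy
      obtain ⟨a, ha⟩ := Finset.card_pos.1 (by omega : 0 < (D.outArcs X).card)
      rw [mem_outArcs] at ha
      exact absurd (hX a trivial ha.1) ha.2

/-- The arc version of Menger's theorem for directed multigraphs. -/
theorem hasDisjointPaths_iff (D : MultiDigraph V A) (x y : V) (n : ℕ) :
    D.HasDisjointPaths x y n ↔
      ∀ X : Set V, x ∈ X → y ∉ X → n ≤ (D.outArcs X).card := by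
  constructor
  · rintro ⟨P, hP, hd⟩ X hx hy
    choose f hf hfX using fun i => (hP i).1.exists_leaving hx hy
    have hinj : Function.Injective f := fun i j hij => by
      by_contra hne
      exact hd hne (hf i) (hij ▸ hf j)
    simpa using Finset.card_le_card_of_injOn (s := Finset.univ) f
      (fun i _ => mem_outArcs.2 (hfX i)) hinj.injOn
  · intro h
    obtain ⟨B, hB⟩ := D.exists_isFlow h
    obtain ⟨P, hP, hd, -⟩ := hB.exists_paths
    exact ⟨P, hP, hd⟩

theorem natCast_le_lam_iff (D : MultiDigraph V A) (x y : V) (n : ℕ) :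
    (n : ℕ∞) ≤ D.lam x y ↔ ∀ X : Set V, x ∈ X → y ∉ X → n ≤ (D.outArcs X).card := by
  constructor
  · intro h X hx hy
    have : D.lam x y ≤ ((D.outArcs X).card : ℕ∞) := iSup₂_le fun m hm =>
      Nat.cast_le.2 ((D.hasDisjointPaths_iff x y m).1 hm X hx hy)
    exact Nat.cast_le.1 (h.trans this)
  · intro h
    exact le_iSup₂_of_le n ((D.hasDisjointPaths_iff x y n).2 h) le_rfl

theorem isArcConnected_iff (D : MultiDigraph V A) (k : ℕ) :
    D.IsArcConnected k ↔ ∀ x y, (k : ℕ∞) ≤ D.lam x y := by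
  simp only [natCast_le_lam_iff]
  constructor
  · intro h x y X hx hy
    by_contra! hlt
    -- The deleted set is the whole cut `D.outArcs X`.
    obtain ⟨P, hP, hPX⟩ := h _ hlt x y
    obtain ⟨a, ha, haX⟩ := hP.1.exists_leaving hx hy
    exact hPX a ha (mem_outArcs.2 haX)
  · intro h B hB x y
    rcases D.exists_path_or_cut {a | a ∉ B} x y with hP | ⟨X, hx, hy, hX⟩
    · exact hP
    · have hsub : D.outArcs X ⊆ B := fun a ha => by
        by_contra haB
        rw [mem_outArcs] at ha
        exact ha.2 (hX a haB ha.1)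
      exact absurd ((h x y X hx hy).trans (Finset.card_le_card hsub)) (by omega)

theorem IsPath.min_le_lam_reversePath {u v : V} {P : List A} (h : D.IsPath u P v) (x y : V) :
    min (D.lam u v - 1) (D.lam x y) ≤ (D.reversePath P).lam x y := by
  classical
  rw [← ENat.forall_natCast_le_iff_le]
  intro n hn
  obtain ⟨h1, h2⟩ := le_min_iff.1 hn
  rw [natCast_le_lam_iff] at h2 ⊢
  intro X hx hy
  have hcard := h.card_outArcs_reversePath X
  have h3 := h2 X hx hy
  by_cases huv : u ∈ X ∧ v ∉ X
  · have h4 : n = 0 ∨ ((n + 1 : ℕ) : ℕ∞) ≤ D.lam u v := by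
      rcases Nat.eq_zero_or_pos n with h0 | h0
      · exact .inl h0
      · right
        cases hl : D.lam u v with
        | top => exact le_top
        | coe m =>
          rw [hl] at h1
          have : n ≤ m - 1 := by exact_mod_cast h1
          exact_mod_cast (by omega : n + 1 ≤ m)
    rcases h4 with h4 | h4
    · omega
    · have := (natCast_le_lam_iff _ _ _ _).1 h4 X huv.1 huv.2
      simp only [huv.1, huv.2, if_true, if_false] at hcard
      omega
  · split_ifs at hcard <;> first | omega | (exfalso; tauto)

/-- The additive form avoids truncated subtraction; for u = v it reads ⊤ + 1 = ⊤, as there are no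
cuts. -/
theorem IsPath.lam_reversePath_add_one {u v : V} {P : List A} (h : D.IsPath u P v) :
    (D.reversePath P).lam u v + 1 = D.lam u v := by
  classical
  refine ENat.eq_of_forall_natCast_le_iff fun n => ?_
  cases n with
  | zero => simp
  | succ n =>
    rw [Nat.cast_succ, ENat.add_le_add_iff_right ENat.one_ne_top, ← Nat.cast_succ,
      natCast_le_lam_iff, natCast_le_lam_iff]
    refine forall_congr' fun X => forall_congr' fun hx => forall_congr' fun hy => ?_
    have hcard := h.card_outArcs_reversePath X
    simp only [hx, hy, if_true, if_false] at hcard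
    omega

theorem IsPath.isFlippable_iff {u v : V} {P : List A} (h : D.IsPath u P v) {k : ℕ}
    (hk : D.IsArcConnected k) : D.IsFlippable k P ↔ (k : ℕ∞) < D.lam u v := by
  rw [IsFlippable, isArcConnected_iff, ← ENat.add_one_le_iff (ENat.natCast_ne_top k)]
  constructor
  · intro hf
    rw [← h.lam_reversePath_add_one]
    exact add_le_add_left (hf u v) 1
  · intro hlt x y
    exact le_trans (le_min (ENat.le_sub_of_add_le_right ENat.one_ne_top hlt)
      ((isArcConnected_iff D k).1 hk x y)) (h.min_le_lam_reversePath x y)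

end Flows

end MultiDigraph

theorem mainTheorem7 {V A : Type*} [Finite V] [Finite A] (D : MultiDigraph V A) (u v : V)
    (P : List A) (hP : D.IsPath u P v) :
    (∀ u' v' : V, min (D.lam u v - 1) (D.lam u' v') ≤ (D.reversePath P).lam u' v') ∧
    (D.reversePath P).lam u v + 1 = D.lam u v ∧
    (∀ k : ℕ, D.IsArcConnected k →
      (D.IsFlippable k P ↔ ∀ Q : List A, D.IsPath u Q v → D.IsFlippable k Q) ∧
      (D.IsFlippable k P ↔ (k : ℕ∞) < D.lam u v)) := by
  have := Fintype.ofFinite A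
  refine ⟨hP.min_le_lam_reversePath, hP.lam_reversePath_add_one, fun k hk =>
    ⟨⟨fun h Q hQ => ?_, fun h => h P hP⟩, hP.isFlippable_iff hk⟩⟩
  exact (hQ.isFlippable_iff hk).2 ((hP.isFlippable_iff hk).1 h)
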